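/- Let $N\ge 1$, $\sigma>0$, $f^*\in\mathbb R^N$, and let $Y=f^*+\epsilon$, where $\epsilon=(\epsilon_1,\dots,\epsilon_N)$ has independent coordinates with law $\mathcal N(0,\sigma^2)$. For a partition $m$ of $\{1,\dots,N\}$ into non-empty parts, let $F_m\subset\mathbb R^N$ be the subspace of vectors that are constant over the parts of $m$, let $\mathrm{Proj}_{F_m}$ be the orthogonal projection onto $F_m$, let $d'_m$ be the number of parts of $m$ minus one, and let $d''_m$ be the number of $i\in\{1,\dots,N-1\}$ such that $i$ and $i+1$ lie in different parts of $m$. Let $S^2(n,k)$ be the number of partitions of $\{1,\dots,n\}$ into $k$ non-empty parts such that any two distinct elements of the same part are at distance at least $2$. Put $$p_m=\frac{\exp(-d'_m-d''_m)}{B\,S^2(d''_m+1,d'_m+1)\binom{N}{d''_m}},$$ $$B_N=\frac{e^3}{(e-1)^2(e+1)}\left(1-e^{-2N}-e^{-N-1}+e^{-2N-1}-e^{-N-2}+e^{-2N-2}\right).$$ Let $\mathcal M$ be the set of partitions $m$ of $\{1,\dots,N\}$ with $e\,d'_m\le N$. Let $B$ be either the explicit constant $B_N$ or any other positive constant such that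 $\sum_{m\in\mathcal M}p_m\le 1$. For $m\in\mathcal M$ let $$\mathrm{pen}(m)=2\ln\frac1{p_m}+(d'_m+1)\ln\frac N{d'_m},$$ where $\ln(N/0)=+\infty$. Let $a>1$ and $K=3a$, and let $\hat m$ be a measurable random element of $\mathcal M$ such that $$\hat m\in\arg\min_{m\in\mathcal M}\left\{\|Y-\mathrm{Proj}_{F_m}Y\|^2+\sigma^2K\,\mathrm{pen}(m)\right\}.$$ Then $\|\mathrm{Proj}_{F_{\hat m}}Y-f^*\|^2$ is integrable and $$\mathbb E\|\mathrm{Proj}_{F_{\hat m}}Y-f^*\|^2\le\min_{m\in\mathcal M}\left\{\frac a{a-1}\mathbb E\|\mathrm{Proj}_{F_m}Y-f^*\|^2+\frac{a^2\sigma^2}{a-1}\left(7+3(d'_m+1)\ln\frac N{d'_m}+6\ln\frac1{p_m}\right)\right\}.$$ -/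

import Mathlib

open MeasureTheory ProbabilityTheory
open scoped NNReal ENNReal

/-- Partitions of the set of the `N` design points, which are indexed by `Fin N`. -/
abbrev DesignPartition (N : ℕ) : Type := Finpartition (Finset.univ : Finset (Fin N))

namespace DesignPartition

/-- The subspace `F_m` of the vectors of `ℝ^N` that are constant over the parts of `m`. -/
def space {N : ℕ} (m : DesignPartition N) : Submodule ℝ (EuclideanSpace ℝ (Fin N)) where
  carrier := {f | ∀ A ∈ m.parts, ∀ i ∈ A, ∀ j ∈ A, f i = f j}
  zero_mem' := fun _ _ _ _ _ _ => rfl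
  add_mem' := fun {f g} hf hg A hA i hi j hj => by
    simp [hf A hA i hi j hj, hg A hA i hi j hj]
  smul_mem' := fun c f hf A hA i hi j hj => by
    simp [hf A hA i hi j hj]

/-- The clustering dimension `d'_m`: the number of parts, minus one. -/
def clusterDim {N : ℕ} (m : DesignPartition N) : ℕ := m.parts.card - 1

/-- The change point dimension `d''_m`: the number of design points that have a successor lying
in a different part. This is the number of segments (maximal intervals contained in a part),
minus one. -/
def changeDim {N : ℕ} (m : DesignPartition N) : ℕ :=
  (Finset.univ.filter fun i : Fin N =>
    ∃ h : (i : ℕ) + 1 < N, m.part i ≠ m.part ⟨(i : ℕ) + 1, h⟩).card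

end DesignPartition

/-- `S²(n, k)`: the number of partitions of `n` consecutive points into `k` non-empty parts such
that any two distinct elements of the same part are at distance at least two. -/
def stirlingTwo (n k : ℕ) : ℕ :=
  (Finset.univ.filter fun π : DesignPartition n =>
    π.parts.card = k ∧ ∀ A ∈ π.parts, ∀ i ∈ A, ∀ j ∈ A, i < j → (i : ℕ) + 2 ≤ (j : ℕ)).card

noncomputable section

open Classical in
/-- The collection `M` of models: the partitions with `e * d'_m ≤ N`. -/
def models (N : ℕ) : Finset (DesignPartition N) :=
  Finset.univ.filter fun m => Real.exp 1 * (m.clusterDim : ℝ) ≤ (N : ℝ)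

/-- The weight `p_m` with normalizing factor `B`. -/
def priorWeight {N : ℕ} (B : ℝ) (m : DesignPartition N) : ℝ :=
  Real.exp (-(m.clusterDim : ℝ) - (m.changeDim : ℝ)) /
    (B * (stirlingTwo (m.changeDim + 1) (m.clusterDim + 1) : ℝ) * (N.choose m.changeDim : ℝ))

/-- The explicit normalizing factor `B_N`. -/
def priorConst (N : ℕ) : ℝ :=
  Real.exp 3 / ((Real.exp 1 - 1) ^ 2 * (Real.exp 1 + 1)) *
    (1 - Real.exp (-(2 * N : ℝ)) - Real.exp (-(N : ℝ) - 1) + Real.exp (-(2 * N : ℝ) - 1)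
      - Real.exp (-(N : ℝ) - 2) + Real.exp (-(2 * N : ℝ) - 2))

/-- `(d'_m + 1) * ln (N / d'_m)`, an extended real number: for `1 ≤ N` it is `+∞` if `d'_m = 0`,
and the usual real number otherwise. -/
def dimTerm {N : ℕ} (m : DesignPartition N) : EReal :=
  ((m.clusterDim + 1 : ℝ) : EReal) * ENNReal.log ((N : ℝ≥0∞) / (m.clusterDim : ℝ≥0∞))

/-- The penalty `pen(m) = 2 ln (1 / p_m) + (d'_m + 1) ln (N / d'_m)`. -/
def penalty {N : ℕ} (B : ℝ) (m : DesignPartition N) : EReal :=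
  ((2 * Real.log (1 / priorWeight B m) : ℝ) : EReal) + dimTerm m

/-- The criterion `‖y - Proj_{F_m} y‖² + σ² K pen(m)`. -/
def criterion {N : ℕ} (σ K B : ℝ) (y : EuclideanSpace ℝ (Fin N)) (m : DesignPartition N) : EReal :=
  ((‖y - m.space.starProjection y‖ ^ 2 : ℝ) : EReal) + ((σ ^ 2 * K : ℝ) : EReal) * penalty B m

end

/-! The proof combines penalized least squares, a union bound over models and a count of partitions.

Minimality of the criterion compares the loss of the selected estimator with that of a fixed model
`m`, up to a cross term `2⟨ε, Proj Y - f⟩`. For the selected model this vector lies in `S = F + ℝ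
f`, of dimension at most `d' + 2`, so Young's inequality bounds the term by a fraction `1/a` of the
loss plus `a ‖Proj_S ε‖²` (`norm_sq_starProjection_sub_le`). For the fixed model a mean-zero linear
term remains.

It remains to bound the mean of `a ‖Proj_S ε‖² - 3 a σ² pen` at the selected model. Since `x ≤ exp
x`, this is at most `6 a σ² exp (‖Proj_S ε‖² / (6 σ²) - pen / 2)`, and the random model is removed
by summing over all models. By the chi-squared exponential moment at `1/6`, the term of `m` has mean
at most `(3/2)^((d'+2)/2) exp (-pen/2)`. Because `ln (N/d') ≥ 1` on the collection, this is at most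
`p_m` (`integral_exp_deviation_le`), and the weights sum to at most one.

For the explicit constant, that last fact is combinatorial. A partition is determined by its change
points and by the partition it induces on its segments, in which neighbours are separated. Hence at
most `S²(d''+1, d'+1) * N.choose d''` partitions have given dimensions (`card_filter_dims_eq_le`),
and a double geometric sum remains. -/

/-! ### Exponential moments of projected Gaussian noise. -/

lemma integral_exp_mul_sq_gaussianReal {v : ℝ≥0} (hv : v ≠ 0) {t : ℝ} (ht : t < 1 / 2) :
    ∫ x, Real.exp (t * x ^ 2 / v) ∂(gaussianReal 0 v) = (√(1 - 2 * t))⁻¹ := by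
  have hv' : (0 : ℝ) < v := by positivity
  have h1 : (0 : ℝ) < 1 - 2 * t := by linarith
  rw [integral_gaussianReal_eq_integral_smul hv]
  have h : ∀ x : ℝ, gaussianPDFReal 0 v x • Real.exp (t * x ^ 2 / v) =
      (√(2 * Real.pi * v))⁻¹ * Real.exp (-((1 - 2 * t) / (2 * v)) * x ^ 2) := by
    intro x
    rw [gaussianPDFReal, smul_eq_mul, mul_assoc, ← Real.exp_add]
    congr 2
    field_simp
    ring
  simp_rw [h]
  rw [integral_const_mul, integral_gaussian, ← Real.sqrt_inv, ← Real.sqrt_mul (by positivity),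
    ← Real.sqrt_inv]
  congr 1
  field_simp

section Noise

variable {Ω : Type*} [MeasurableSpace Ω] {P : Measure Ω}
  {N : ℕ} {v : ℝ≥0} {ε : Ω → EuclideanSpace ℝ (Fin N)}

lemma hasGaussianLaw_of_iIndepFun_coord
    (hlaw : ∀ i, HasLaw (fun ω => ε ω i) (gaussianReal 0 v) P)
    (hindep : iIndepFun (fun i ω => ε ω i) P) : HasGaussianLaw ε P := by
  have h := (iIndepFun.hasGaussianLaw (fun i => (hlaw i).hasGaussianLaw) hindep).toLp_pi 2
  exact h

lemma integral_inner_noise_eq_zero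
    (hlaw : ∀ i, HasLaw (fun ω => ε ω i) (gaussianReal 0 v) P)
    (x : EuclideanSpace ℝ (Fin N)) : ∫ ω, inner ℝ x (ε ω) ∂P = 0 := by
  simp only [PiLp.inner_apply, RCLike.inner_apply, conj_trivial]
  rw [integral_finsetSum _ fun i _ => (hlaw i).hasGaussianLaw.integrable.mul_const _]
  refine Finset.sum_eq_zero fun i _ => ?_
  rw [integral_mul_const, (hlaw i).integral_eq, integral_id_gaussianReal, zero_mul]

variable [IsProbabilityMeasure P]

lemma covariance_inner_noise
    (hlaw : ∀ i, HasLaw (fun ω => ε ω i) (gaussianReal 0 v) P)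
    (hindep : iIndepFun (fun i ω => ε ω i) P) (x y : EuclideanSpace ℝ (Fin N)) :
    cov[fun ω => inner ℝ x (ε ω), fun ω => inner ℝ y (ε ω); P] = v * inner ℝ x y := by
  have hL : ∀ i, MemLp (fun ω => ε ω i) 2 P := fun i => (hlaw i).hasGaussianLaw.memLp_two
  have hcov : ∀ i j, cov[fun ω => ε ω i, fun ω => ε ω j; P] = if i = j then (v : ℝ) else 0 := by
    intro i j
    split_ifs with h
    · subst h
      rw [covariance_self (hlaw i).aemeasurable, (hlaw i).variance_eq, variance_id_gaussianReal]
    · exact (hindep.indepFun h).covariance_eq_zero (hL i) (hL j)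
  simp only [PiLp.inner_apply, RCLike.inner_apply, conj_trivial]
  rw [covariance_fun_sum_fun_sum (fun i => (hL i).mul_const _) (fun i => (hL i).mul_const _)]
  simp_rw [covariance_mul_const_left, covariance_mul_const_right, hcov]
  simp only [ite_mul, zero_mul, Finset.sum_ite_eq, Finset.mem_univ, if_true, Finset.mul_sum]
  exact Finset.sum_congr rfl fun i _ => by ring

lemma hasLaw_inner_noise
    (hlaw : ∀ i, HasLaw (fun ω => ε ω i) (gaussianReal 0 v) P)
    (hindep : iIndepFun (fun i ω => ε ω i) P) {x : EuclideanSpace ℝ (Fin N)} (hx : ‖x‖ = 1) :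
    HasLaw (fun ω => inner ℝ x (ε ω)) (gaussianReal 0 v) P := by
  have hG : HasGaussianLaw (fun ω => inner ℝ x (ε ω)) P :=
    (hasGaussianLaw_of_iIndepFun_coord hlaw hindep).map_fun (innerSL ℝ x)
  refine ⟨hG.aemeasurable, ?_⟩
  rw [hG.map_eq_gaussianReal, integral_inner_noise_eq_zero hlaw, ← covariance_self hG.aemeasurable,
    covariance_inner_noise hlaw hindep, real_inner_self_eq_norm_sq, hx]
  simp

/-- The squared norm of the projection of the noise has the exponential moments of a
chi-squared variable with `finrank ℝ S` degrees of freedom. -/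
lemma integral_exp_norm_sq_starProjection
    (hlaw : ∀ i, HasLaw (fun ω => ε ω i) (gaussianReal 0 v) P)
    (hindep : iIndepFun (fun i ω => ε ω i) P) (hv : v ≠ 0)
    (S : Submodule ℝ (EuclideanSpace ℝ (Fin N))) {t : ℝ} (ht : t < 1 / 2) :
    ∫ ω, Real.exp (t * ‖S.starProjection (ε ω)‖ ^ 2 / v) ∂P =
      (√(1 - 2 * t))⁻¹ ^ Module.finrank ℝ S := by
  let b := stdOrthonormalBasis ℝ S
  let X : Fin (Module.finrank ℝ S) → Ω → ℝ := fun j ω =>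
    inner ℝ (b j : EuclideanSpace ℝ (Fin N)) (ε ω)
  have hb : ∀ j, ‖(b j : EuclideanSpace ℝ (Fin N))‖ = 1 := fun j => b.orthonormal.1 j
  have hX : ∀ j, HasLaw (X j) (gaussianReal 0 v) P := fun j => hasLaw_inner_noise hlaw hindep (hb j)
  have hG : HasGaussianLaw (fun ω => (X · ω)) P :=
    (hasGaussianLaw_of_iIndepFun_coord hlaw hindep).map_fun
      (ContinuousLinearMap.pi fun j => innerSL ℝ (b j : EuclideanSpace ℝ (Fin N)))
  -- The coordinates in an orthonormal basis of `S` are jointly Gaussian and uncorrelated, hence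
  -- independent.
  have hXi : iIndepFun X P := by
    refine hG.iIndepFun_of_covariance_eq_zero fun i j hij => ?_
    have h0 : inner ℝ (b i : EuclideanSpace ℝ (Fin N)) (b j : EuclideanSpace ℝ (Fin N)) = (0 : ℝ) :=
      b.orthonormal.2 hij
    rw [covariance_inner_noise hlaw hindep, h0, mul_zero]
  have hnorm : ∀ ω, ‖S.starProjection (ε ω)‖ ^ 2 = ∑ j, X j ω ^ 2 := by
    intro ω
    change ‖S.orthogonalProjectionOnto (ε ω)‖ ^ 2 = _
    rw [← b.sum_sq_norm_inner_right]
    refine Finset.sum_congr rfl fun j _ => ?_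
    rw [Real.norm_eq_abs, sq_abs, Submodule.coe_inner, ← Submodule.starProjection_apply,
      ← Submodule.inner_starProjection_left_eq_right,
      Submodule.starProjection_eq_self_iff.2 (b j).2]
  have hexp : ∀ ω, Real.exp (t * ‖S.starProjection (ε ω)‖ ^ 2 / v) =
      ∏ j, Real.exp (t * X j ω ^ 2 / v) := by
    intro ω
    rw [hnorm, ← Real.exp_sum, Finset.mul_sum, Finset.sum_div]
  simp_rw [hexp]
  rw [hXi.integral_fun_prod_comp (f := fun _ x => Real.exp (t * x ^ 2 / v))
    (fun j => (hX j).aemeasurable) (fun j => by fun_prop)]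
  have h1 : ∀ j, ∫ ω, Real.exp (t * X j ω ^ 2 / v) ∂P = (√(1 - 2 * t))⁻¹ := by
    intro j
    rw [← integral_exp_mul_sq_gaussianReal hv ht]
    exact (hX j).integral_comp (f := fun x => Real.exp (t * x ^ 2 / v)) (by fun_prop)
  simp [h1]

/-- A non-integrable function has Bochner integral zero, whereas the value computed above is
positive. -/
lemma integrable_exp_norm_sq_starProjection
    (hlaw : ∀ i, HasLaw (fun ω => ε ω i) (gaussianReal 0 v) P)
    (hindep : iIndepFun (fun i ω => ε ω i) P) (hv : v ≠ 0)
    (S : Submodule ℝ (EuclideanSpace ℝ (Fin N))) {t : ℝ} (ht : t < 1 / 2) :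
    Integrable (fun ω => Real.exp (t * ‖S.starProjection (ε ω)‖ ^ 2 / v)) P := by
  refine Integrable.of_integral_ne_zero ?_
  have h1 : (0 : ℝ) < 1 - 2 * t := by linarith
  rw [integral_exp_norm_sq_starProjection hlaw hindep hv S ht]
  positivity

end Noise

/-! ### Counting partitions by change points and induced partitions of the segments. -/

lemma Finset.card_image_le_card_image_of_imp {α β γ : Type*} [DecidableEq β] [DecidableEq γ]
    {s : Finset α} {f : α → β} {g : α → γ} (h : ∀ x ∈ s, ∀ y ∈ s, f x = f y → g x = g y) :
    (s.image g).card ≤ (s.image f).card := by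
  classical
  rcases s.eq_empty_or_nonempty with rfl | ⟨x₀, _⟩
  · simp
  have hex : ∀ b, ∃ c, ∀ x ∈ s, f x = b → g x = c := by
    intro b
    by_cases hb : ∃ y ∈ s, f y = b
    · obtain ⟨y, hy, rfl⟩ := hb
      exact ⟨g y, fun x hx hxy => h x hx y hy hxy⟩
    · push Not at hb
      exact ⟨g x₀, fun x hx hxb => absurd hxb (hb x hx)⟩
  choose φ hφ using hex
  have : s.image g = (s.image f).image φ := by
    rw [Finset.image_image]
    exact Finset.image_congr fun x hx => hφ (f x) x hx rfl
  rw [this]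
  exact Finset.card_image_le

lemma Finset.card_image_eq_card_image_of_iff {α β γ : Type*} [DecidableEq β] [DecidableEq γ]
    {s : Finset α} {f : α → β} {g : α → γ} (h : ∀ x ∈ s, ∀ y ∈ s, f x = f y ↔ g x = g y) :
    (s.image f).card = (s.image g).card :=
  le_antisymm (Finset.card_image_le_card_image_of_imp fun x hx y hy => (h x hx y hy).2)
    (Finset.card_image_le_card_image_of_imp fun x hx y hy => (h x hx y hy).1)

lemma Finpartition.parts_eq_image_part {α : Type*} [DecidableEq α] {s : Finset α}
    (P : Finpartition s) : P.parts = s.image P.part := by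
  ext A
  rw [Finset.mem_image]
  constructor
  · intro hA
    obtain ⟨x, hx⟩ := P.nonempty_of_mem_parts hA
    exact ⟨x, P.subset hA hx, P.part_eq_of_mem hA hx⟩
  · rintro ⟨x, hx, rfl⟩
    exact P.part_mem.2 hx

lemma Finpartition.eq_of_part_eq_iff {α : Type*} [DecidableEq α] [Fintype α]
    {P Q : Finpartition (Finset.univ : Finset α)}
    (h : ∀ x y, P.part x = P.part y ↔ Q.part x = Q.part y) : P = Q := by
  have hpart : P.part = Q.part := by
    funext x
    ext y
    rw [P.mem_part_iff_part_eq_part (Finset.mem_univ _) (Finset.mem_univ _),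
      Q.mem_part_iff_part_eq_part (Finset.mem_univ _) (Finset.mem_univ _)]
    exact h _ _
  ext1
  rw [P.parts_eq_image_part, Q.parts_eq_image_part, hpart]

namespace DesignPartition

variable {N : ℕ}

/-- The points that have a successor lying in a different part. -/
def changeSet (m : DesignPartition N) : Finset (Fin N) :=
  Finset.univ.filter fun i : Fin N =>
    ∃ h : (i : ℕ) + 1 < N, m.part i ≠ m.part ⟨(i : ℕ) + 1, h⟩

lemma mem_changeSet {m : DesignPartition N} {i : Fin N} :
    i ∈ m.changeSet ↔ ∃ h : (i : ℕ) + 1 < N, m.part i ≠ m.part ⟨(i : ℕ) + 1, h⟩ := by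
  simp [changeSet]

lemma card_changeSet (m : DesignPartition N) : m.changeSet.card = m.changeDim := rfl

/-- The index of the segment of `i`, when the segments end at the points of `C`. -/
def segment (C : Finset (Fin N)) (i : ℕ) : ℕ := (C.filter fun c : Fin N => (c : ℕ) < i).card

lemma segment_zero (C : Finset (Fin N)) : segment C 0 = 0 := by simp [segment]

lemma segment_mono (C : Finset (Fin N)) : Monotone (segment C) := fun _ _ hij =>
  Finset.card_le_card fun c hc => by
    simp only [Finset.mem_filter] at hc ⊢
    exact ⟨hc.1, hc.2.trans_le hij⟩

lemma segment_le_card (C : Finset (Fin N)) (i : ℕ) : segment C i ≤ C.card :=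
  Finset.card_filter_le _ _

lemma segment_succ_le (C : Finset (Fin N)) (i : ℕ) : segment C (i + 1) ≤ segment C i + 1 := by
  by_cases hi : i < N
  · refine (Finset.card_le_card (t := insert ⟨i, hi⟩ (C.filter fun c : Fin N => (c : ℕ) < i))
      fun c hc => ?_).trans (Finset.card_insert_le _ _)
    simp only [Finset.mem_filter, Finset.mem_insert, Fin.ext_iff] at hc ⊢
    rcases Nat.lt_succ_iff_lt_or_eq.1 hc.2 with h | h
    · exact Or.inr ⟨hc.1, h⟩
    · exact Or.inl h
  · refine (Finset.card_le_card fun c hc => ?_).trans (Nat.le_succ _)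
    simp only [Finset.mem_filter] at hc ⊢
    exact ⟨hc.1, by omega⟩

lemma segment_lt_of_mem {C : Finset (Fin N)} {c : Fin N} (hc : c ∈ C) {i j : ℕ}
    (hi : i ≤ c) (hj : (c : ℕ) < j) : segment C i < segment C j := by
  refine Finset.card_lt_card ?_
  rw [Finset.ssubset_iff_of_subset]
  · refine ⟨c, ?_, ?_⟩ <;> simp [hc, hj, hi]
  · intro d hd
    simp only [Finset.mem_filter] at hd ⊢
    exact ⟨hd.1, by omega⟩

lemma exists_mem_of_segment_lt {C : Finset (Fin N)} {i j : ℕ} (h : segment C i < segment C j) :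
    ∃ c ∈ C, i ≤ (c : ℕ) ∧ (c : ℕ) < j := by
  by_contra! hcon
  refine absurd h (not_lt.2 (Finset.card_le_card fun c hc => ?_))
  simp only [Finset.mem_filter] at hc ⊢
  refine ⟨hc.1, ?_⟩
  by_contra! hi
  exact absurd hc.2 (not_lt.2 (hcon c hc.1 hi))

/-- A discrete intermediate value theorem: the segment index starts at zero and climbs by at most
one. -/
lemma exists_segment_eq_of_le (C : Finset (Fin N)) (i : ℕ) {u : ℕ} (hu : u ≤ segment C i) :
    ∃ j ≤ i, segment C j = u := by
  induction i with
  | zero => exact ⟨0, le_rfl, by rw [segment_zero] at *; omega⟩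
  | succ i ih =>
    by_cases h : u ≤ segment C i
    · obtain ⟨j, hj, h⟩ := ih h
      exact ⟨j, by omega, h⟩
    · have := segment_succ_le C i
      exact ⟨i + 1, le_rfl, by omega⟩

lemma exists_segment_eq (hN : 1 ≤ N) (m : DesignPartition N) (u : Fin (m.changeSet.card + 1)) :
    ∃ i : Fin N, segment m.changeSet i = u := by
  -- A change point has a successor, so all of them lie strictly before the last point `N - 1`.
  have hlast : segment m.changeSet (N - 1) = m.changeSet.card := by
    unfold segment
    rw [Finset.filter_true_of_mem]
    intro c hc
    obtain ⟨h, -⟩ := mem_changeSet.1 hc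
    omega
  obtain ⟨j, hj, h⟩ := exists_segment_eq_of_le m.changeSet (N - 1) (u := u) (by omega)
  exact ⟨⟨j, by omega⟩, h⟩

lemma part_eq_part_of_segment_eq (m : DesignPartition N) {i j : Fin N}
    (h : segment m.changeSet i = segment m.changeSet j) : m.part i = m.part j := by
  wlog hij : i ≤ j generalizing i j
  · exact (this h.symm (le_of_not_ge hij)).symm
  obtain ⟨i, hi⟩ := i
  obtain ⟨j, hj⟩ := j
  simp only [Fin.mk_le_mk] at hij h
  induction j, hij using Nat.le_induction with
  | base => rfl
  | succ j hij ih =>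
    have h1 := segment_mono m.changeSet hij
    have h2 := segment_mono m.changeSet (Nat.le_succ j)
    simp only [Nat.succ_eq_add_one] at h1 h2
    rw [ih (by omega) (by omega)]
    by_contra hne
    have hmem : (⟨j, by omega⟩ : Fin N) ∈ m.changeSet := mem_changeSet.2 ⟨hj, hne⟩
    have := segment_lt_of_mem hmem (i := j) (j := j + 1) le_rfl (Nat.lt_succ_self j)
    omega

lemma part_ne_part_of_segment_succ (m : DesignPartition N) {i j : Fin N}
    (h : segment m.changeSet j = segment m.changeSet i + 1) : m.part i ≠ m.part j := by
  obtain ⟨c, hc, hic, hcj⟩ := exists_mem_of_segment_lt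
    (show segment m.changeSet i < segment m.changeSet j by omega)
  obtain ⟨hc1, hne⟩ := mem_changeSet.1 hc
  have h1 := segment_mono m.changeSet hic
  have h2 := segment_mono m.changeSet (Nat.succ_le_of_lt hcj)
  have h3 := segment_lt_of_mem hc le_rfl (Nat.lt_succ_self c)
  simp only [Nat.succ_eq_add_one] at h1 h2 h3
  -- Monotonicity and the strict jump at `c` squeeze the indices: `i` shares the segment of `c`, and
  -- `j` that of `c + 1`.
  have e1 : m.part i = m.part c := m.part_eq_part_of_segment_eq (by omega)
  have e2 : m.part ⟨(c : ℕ) + 1, hc1⟩ = m.part j :=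
    m.part_eq_part_of_segment_eq (by simp only; omega)
  rw [e1, ← e2]
  exact hne

open Classical in
/-- The partition of `Fin n` for which `u` and `v` are equivalent when `t u` and `t v` lie in the
same part of `m`. -/
noncomputable def pullback (m : DesignPartition N) {n : ℕ} (t : Fin n → Fin N) :
    DesignPartition n :=
  Finpartition.ofSetoid (Setoid.ker fun u => m.part (t u))

lemma part_pullback (m : DesignPartition N) {n : ℕ} (t : Fin n → Fin N) (u v : Fin n) :
    (m.pullback t).part u = (m.pullback t).part v ↔ m.part (t u) = m.part (t v) := by
  classical
  rw [← Finpartition.mem_part_iff_part_eq_part _ (Finset.mem_univ _) (Finset.mem_univ _), pullback,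
    Finpartition.mem_part_ofSetoid_iff_rel]
  simp only [Setoid.ker_def, eq_comm]

lemma part_section (m : DesignPartition N) {t : Fin (m.changeSet.card + 1) → Fin N}
    (ht : ∀ u, segment m.changeSet (t u) = u) (i : Fin N) :
    m.part (t ⟨segment m.changeSet i, Nat.lt_succ_of_le (segment_le_card _ _)⟩) = m.part i :=
  m.part_eq_part_of_segment_eq (ht _)

lemma card_parts_pullback (m : DesignPartition N) {t : Fin (m.changeSet.card + 1) → Fin N}
    (ht : ∀ u, segment m.changeSet (t u) = u) :
    (m.pullback t).parts.card = m.parts.card := by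
  rw [Finpartition.parts_eq_image_part,
    Finset.card_image_eq_card_image_of_iff (g := fun u => m.part (t u))
      fun u _ v _ => part_pullback m t u v]
  congr 1
  rw [Finpartition.parts_eq_image_part]
  ext A
  simp only [Finset.mem_image, Finset.mem_univ, true_and]
  constructor
  · rintro ⟨u, rfl⟩
    exact ⟨t u, rfl⟩
  · rintro ⟨i, rfl⟩
    exact ⟨_, m.part_section ht i⟩

lemma pullback_separated (m : DesignPartition N) {t : Fin (m.changeSet.card + 1) → Fin N}
    (ht : ∀ u, segment m.changeSet (t u) = u) :
    ∀ A ∈ (m.pullback t).parts, ∀ i ∈ A, ∀ j ∈ A, i < j → (i : ℕ) + 2 ≤ (j : ℕ) := by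
  intro A hA i hi j hj hij
  by_contra! hlt
  have hij' : (j : ℕ) = i + 1 := by
    have : (i : ℕ) < j := hij
    omega
  refine m.part_ne_part_of_segment_succ (i := t i) (j := t j) (by rw [ht, ht, hij']) ?_
  rw [← part_pullback, Finpartition.part_eq_of_mem _ hA hi, Finpartition.part_eq_of_mem _ hA hj]

/-- Each point lies in the same part as the representative `t` of its segment, so the classes of the
segments determine the partition. -/
lemma pullback_injOn (C : Finset (Fin N)) {t : Fin (C.card + 1) → Fin N}
    (ht : ∀ u, segment C (t u) = u) {m m' : DesignPartition N} (hm : m.changeSet = C)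
    (hm' : m'.changeSet = C) (h : m.pullback t = m'.pullback t) : m = m' := by
  refine Finpartition.eq_of_part_eq_iff fun i j => ?_
  have key : ∀ m : DesignPartition N, m.changeSet = C → (m.part i = m.part j ↔
      (m.pullback t).part ⟨segment C i, Nat.lt_succ_of_le (segment_le_card _ _)⟩ =
      (m.pullback t).part ⟨segment C j, Nat.lt_succ_of_le (segment_le_card _ _)⟩) := by
    rintro m rfl
    rw [part_pullback, m.part_section ht, m.part_section ht]
  rw [key m hm, key m' hm', h]

lemma card_parts_pos (hN : 1 ≤ N) (m : DesignPartition N) : 0 < m.parts.card :=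
  Finset.card_pos.2 ⟨m.part ⟨0, hN⟩, m.part_mem.2 (Finset.mem_univ _)⟩

lemma clusterDim_add_one (hN : 1 ≤ N) (m : DesignPartition N) :
    m.clusterDim + 1 = m.parts.card :=
  Nat.sub_add_cancel (m.card_parts_pos hN)

/-- The induced partition splits `d'' + 1` segments into `d' + 1` non-empty parts. -/
lemma clusterDim_le_changeDim (hN : 1 ≤ N) (m : DesignPartition N) :
    m.clusterDim ≤ m.changeDim := by
  choose t ht using m.exists_segment_eq hN
  have h := (m.pullback t).card_parts_le_card
  rw [m.card_parts_pullback ht, Finset.card_univ, Fintype.card_fin, card_changeSet,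
    ← m.clusterDim_add_one hN] at h
  omega

lemma changeDim_lt (hN : 1 ≤ N) (m : DesignPartition N) : m.changeDim < N := by
  rw [← card_changeSet]
  refine (Finset.card_lt_univ_of_notMem (x := ⟨N - 1, by omega⟩) fun h => ?_).trans_eq
    (Fintype.card_fin N)
  obtain ⟨h, -⟩ := mem_changeSet.1 h
  simp only at h
  omega

lemma card_filter_changeSet_eq_le (hN : 1 ≤ N) (C : Finset (Fin N)) (k : ℕ) :
    (Finset.univ.filter fun m : DesignPartition N => m.clusterDim = k ∧ m.changeSet = C).card ≤
      stirlingTwo (C.card + 1) (k + 1) := by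
  rcases Finset.eq_empty_or_nonempty
    (Finset.univ.filter fun m : DesignPartition N => m.clusterDim = k ∧ m.changeSet = C)
    with h | ⟨m₀, hm₀⟩
  · simp [h]
  -- The section `t` must depend on `C` alone, to serve all counted partitions at once. Its
  -- existence uses that `C` is the change set of some `m₀`: it fails if `C` contains the last
  -- point.
  have hC := (Finset.mem_filter.1 hm₀).2.2
  have hex : ∀ u : Fin (C.card + 1), ∃ i : Fin N, segment C i = u := by
    rw [← hC]
    exact m₀.exists_segment_eq hN
  choose t ht using hex
  refine Finset.card_le_card_of_injOn (fun m => m.pullback t) (fun m hm => ?_)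
    fun m hm m' hm' h => ?_
  · obtain ⟨rfl, rfl⟩ := (Finset.mem_filter.1 hm).2
    refine Finset.mem_filter.2 ⟨Finset.mem_univ _, ?_, m.pullback_separated ht⟩
    rw [m.card_parts_pullback ht, m.clusterDim_add_one hN]
  · exact pullback_injOn C ht (Finset.mem_filter.1 hm).2.2 (Finset.mem_filter.1 hm').2.2 h

/-- The partition `m` is itself counted in a set of at most this size. Hence no weight is a division
by zero, and `p_m > 0`. -/
lemma stirlingTwo_pos (hN : 1 ≤ N) (m : DesignPartition N) :
    0 < stirlingTwo (m.changeDim + 1) (m.clusterDim + 1) := by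
  refine lt_of_lt_of_le (Finset.card_pos.2 ⟨m, ?_⟩)
    (card_filter_changeSet_eq_le hN m.changeSet m.clusterDim)
  simp

lemma card_filter_dims_eq_le (hN : 1 ≤ N) (k l : ℕ) :
    (Finset.univ.filter fun m : DesignPartition N => m.clusterDim = k ∧ m.changeDim = l).card ≤
      stirlingTwo (l + 1) (k + 1) * N.choose l := by
  rw [Finset.card_eq_sum_card_fiberwise (f := changeSet)
    (t := Finset.univ.powersetCard l) (fun m hm => ?_)]
  · rw [mul_comm, show N.choose l = ((Finset.univ : Finset (Fin N)).powersetCard l).card by simp,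
      ← smul_eq_mul]
    refine Finset.sum_le_card_nsmul _ _ _ fun C hC => ?_
    obtain ⟨-, rfl⟩ := Finset.mem_powersetCard.1 hC
    refine (Finset.card_le_card fun m hm => ?_).trans (card_filter_changeSet_eq_le hN C k)
    simp only [Finset.mem_filter, Finset.mem_univ, true_and] at hm ⊢
    exact ⟨hm.1.1, hm.2⟩
  · exact Finset.mem_powersetCard.2 ⟨Finset.subset_univ _, (Finset.mem_filter.1 hm).2.2⟩

end DesignPartition

/-! ### The prior weights and their normalization. -/

lemma priorWeight_nonneg {N : ℕ} {B : ℝ} (hB : 0 < B) (m : DesignPartition N) :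
    0 ≤ priorWeight B m := by
  unfold priorWeight
  positivity

lemma priorWeight_pos {N : ℕ} (hN : 1 ≤ N) {B : ℝ} (hB : 0 < B) (m : DesignPartition N) :
    0 < priorWeight B m := by
  have h1 := m.stirlingTwo_pos hN
  have h2 := Nat.choose_pos (m.changeDim_lt hN).le
  unfold priorWeight
  positivity

lemma sum_geometric_triangle (x : ℝ) (N : ℕ) :
    (1 - x) * (1 - x ^ 2) * ∑ l ∈ Finset.range N, ∑ k ∈ Finset.range (l + 1), x ^ (k + l) =
      1 - x ^ N - x ^ (N + 1) + x ^ (2 * N + 1) := by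
  have hin : ∀ l, (1 - x) * ∑ k ∈ Finset.range (l + 1), x ^ (k + l) = x ^ l * (1 - x ^ (l + 1)) := by
    intro l
    simp_rw [pow_add, ← Finset.sum_mul]
    rw [← mul_assoc, mul_neg_geom_sum]
    ring
  induction N with
  | zero => simp
  | succ N ih =>
    rw [Finset.sum_range_succ, mul_add, ih, mul_right_comm, hin]
    ring

/-- With `x = exp (-1)`, the explicit constant exceeds the triangular sum by `x ^ N * (1 - x ^ N) /
(1 - x)`. This is an extra row `l = N`, `k < N`, whereas the change dimension is at most `N - 1`. -/
lemma sum_geometric_triangle_le_priorConst (N : ℕ) :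
    ∑ l ∈ Finset.range N, ∑ k ∈ Finset.range (l + 1), Real.exp (-1) ^ (k + l) ≤ priorConst N := by
  have hx0 := Real.exp_pos (-1)
  have hx1 : Real.exp (-1) < 1 := by rw [Real.exp_lt_one_iff]; norm_num
  have hex : Real.exp 1 = (Real.exp (-1))⁻¹ := by rw [Real.exp_neg, inv_inv]
  have h3 : Real.exp 3 = (Real.exp (-1))⁻¹ ^ 3 := by
    rw [← hex, ← Real.exp_nat_mul]
    norm_num
  have e1 : Real.exp (-(2 * N : ℝ)) = Real.exp (-1) ^ (2 * N) := by
    rw [← Real.exp_nat_mul]; push_cast; ring_nf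
  have e2 : Real.exp (-(N : ℝ) - 1) = Real.exp (-1) ^ (N + 1) := by
    rw [← Real.exp_nat_mul]; push_cast; ring_nf
  have e3 : Real.exp (-(2 * N : ℝ) - 1) = Real.exp (-1) ^ (2 * N + 1) := by
    rw [← Real.exp_nat_mul]; push_cast; ring_nf
  have e4 : Real.exp (-(N : ℝ) - 2) = Real.exp (-1) ^ (N + 2) := by
    rw [← Real.exp_nat_mul]; push_cast; ring_nf
  have e5 : Real.exp (-(2 * N : ℝ) - 2) = Real.exp (-1) ^ (2 * N + 2) := by
    rw [← Real.exp_nat_mul]; push_cast; ring_nf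
  have hT := sum_geometric_triangle (Real.exp (-1)) N
  rw [priorConst, e1, e2, e3, e4, e5, hex, h3]
  generalize Real.exp (-1) = x at *
  have hd : 0 < (1 - x) * (1 - x ^ 2) :=
    mul_pos (by linarith) (by nlinarith)
  have hc : x⁻¹ ^ 3 / ((x⁻¹ - 1) ^ 2 * (x⁻¹ + 1)) = 1 / ((1 - x) * (1 - x ^ 2)) := by
    have h1 : (1 - x) ≠ 0 := by linarith
    have h2 : x⁻¹ - 1 = (1 - x) / x := by field_simp
    have h4 : x⁻¹ + 1 = (1 + x) / x := by field_simp
    have h5 : (1 + x) ≠ 0 := by linarith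
    have h6 : 1 - x ^ 2 = (1 - x) * (1 + x) := by ring
    rw [h2, h4, h6]
    field_simp
  rw [hc, one_div_mul_eq_div, le_div_iff₀' hd, hT]
  have hp : x ^ N ≤ 1 := pow_le_one₀ hx0.le hx1.le
  have hp0 : 0 < x ^ N := pow_pos hx0 N
  have hdiff : 0 ≤ (1 - x ^ 2) * (x ^ N * (1 - x ^ N)) :=
    mul_nonneg (by nlinarith) (mul_nonneg hp0.le (by linarith))
  have : 1 - x ^ (2 * N) - x ^ (N + 1) + x ^ (2 * N + 1) - x ^ (N + 2) + x ^ (2 * N + 2) =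
      1 - x ^ N - x ^ (N + 1) + x ^ (2 * N + 1) + (1 - x ^ 2) * (x ^ N * (1 - x ^ N)) := by
    ring
  linarith

lemma priorConst_pos {N : ℕ} (hN : 1 ≤ N) : 0 < priorConst N := by
  refine lt_of_lt_of_le ?_ (sum_geometric_triangle_le_priorConst N)
  refine Finset.sum_pos (fun l _ => Finset.sum_pos (fun k _ => pow_pos (Real.exp_pos _) _) ?_) ?_
  · exact ⟨0, by simp⟩
  · exact ⟨0, Finset.mem_range.2 hN⟩

open DesignPartition in
lemma sum_priorWeight_priorConst_le_one {N : ℕ} (hN : 1 ≤ N) :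
    ∑ m ∈ models N, priorWeight (priorConst N) m ≤ 1 := by
  have hB := priorConst_pos hN
  have hw : ∀ m : DesignPartition N, priorWeight (priorConst N) m =
      (fun p : (_ : ℕ) × ℕ => Real.exp (-1) ^ (p.2 + p.1) / (priorConst N *
        (stirlingTwo (p.1 + 1) (p.2 + 1) : ℝ) * (N.choose p.1 : ℝ))) ⟨m.changeDim, m.clusterDim⟩ := by
    intro m
    simp only [priorWeight]
    rw [← Real.exp_nat_mul]
    congr 2
    push_cast
    ring
  calc ∑ m ∈ models N, priorWeight (priorConst N) m
      ≤ ∑ m : DesignPartition N, priorWeight (priorConst N) m :=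
        Finset.sum_le_sum_of_subset_of_nonneg (Finset.subset_univ _)
          fun m _ _ => priorWeight_nonneg hB m
    _ ≤ ∑ p ∈ (Finset.range N).sigma fun l => Finset.range (l + 1),
          Real.exp (-1) ^ (p.2 + p.1) / priorConst N := by
        rw [← Finset.sum_fiberwise_of_maps_to
          (g := fun m : DesignPartition N => (⟨m.changeDim, m.clusterDim⟩ : (_ : ℕ) × ℕ))
          (t := (Finset.range N).sigma fun l => Finset.range (l + 1)) fun m _ => ?_]
        · refine Finset.sum_le_sum fun p _ => ?_
          obtain ⟨l, k⟩ := p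
          simp_rw [hw]
          rw [Finset.sum_congr rfl (g := fun _ => Real.exp (-1) ^ (k + l) / (priorConst N *
            (stirlingTwo (l + 1) (k + 1) : ℝ) * (N.choose l : ℝ))), Finset.sum_const, nsmul_eq_mul]
          · have hcard : ((Finset.univ.filter fun m : DesignPartition N =>
                (⟨m.changeDim, m.clusterDim⟩ : (_ : ℕ) × ℕ) = ⟨l, k⟩).card : ℝ) ≤
                (stirlingTwo (l + 1) (k + 1) : ℝ) * (N.choose l : ℝ) := by
              rw [← Nat.cast_mul]
              refine Nat.cast_le.2 (le_trans ?_ (card_filter_dims_eq_le hN k l))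
              refine Finset.card_le_card fun m hm => ?_
              simp only [Finset.mem_filter, Finset.mem_univ, true_and, Sigma.mk.injEq,
                heq_eq_eq] at hm ⊢
              exact ⟨hm.2, hm.1⟩
            have h0 : (0 : ℝ) ≤ (stirlingTwo (l + 1) (k + 1) : ℝ) * (N.choose l : ℝ) := by positivity
            have hx : 0 < Real.exp (-1) ^ (k + l) := by positivity
            -- The separated Stirling number can vanish, for instance if `k = 0 < l`; the weight is
            -- then `0` by the convention for division by zero.
            rcases h0.eq_or_lt with h0 | h0
            · rw [mul_assoc, ← h0, mul_zero, div_zero, mul_zero]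
              positivity
            · rw [mul_assoc, ← div_div, mul_div_assoc', div_le_iff₀ h0, mul_comm]
              exact mul_le_mul_of_nonneg_left hcard (by positivity)
          · intro m hm
            obtain ⟨rfl, h⟩ := Sigma.mk.inj_iff.1 (Finset.mem_filter.1 hm).2
            rw [eq_of_heq h]
        · simp only [Finset.mem_sigma, Finset.mem_range]
          exact ⟨m.changeDim_lt hN, Nat.lt_succ_of_le (m.clusterDim_le_changeDim hN)⟩
    _ ≤ 1 := by
        rw [← Finset.sum_div, div_le_one hB, Finset.sum_sigma]
        exact sum_geometric_triangle_le_priorConst N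

/-! ### Dimensions of the model spaces and the deterministic comparison of losses. -/

namespace DesignPartition

variable {N : ℕ}

lemma finrank_space_le (m : DesignPartition N) : Module.finrank ℝ m.space ≤ m.parts.card := by
  -- A vector of the model space is determined by its values at one representative of each part.
  let rep : m.parts → Fin N := fun A => (m.nonempty_of_mem_parts A.2).choose
  have hrep : ∀ A, rep A ∈ A.1 := fun A => (m.nonempty_of_mem_parts A.2).choose_spec
  let L : m.space →ₗ[ℝ] (m.parts → ℝ) :=
    { toFun := fun g A => g.1 (rep A)
      map_add' := fun _ _ => rfl
      map_smul' := fun _ _ => rfl }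
  have hL : Function.Injective L := by
    intro g h hgh
    ext i
    have hi : m.part i ∈ m.parts := m.part_mem.2 (Finset.mem_univ _)
    have hi' : i ∈ m.part i := m.mem_part_self.2 (Finset.mem_univ _)
    rw [g.2 _ hi i hi' _ (hrep ⟨_, hi⟩), h.2 _ hi i hi' _ (hrep ⟨_, hi⟩)]
    exact congrFun hgh ⟨_, hi⟩
  simpa using LinearMap.finrank_le_finrank_of_injective hL

/-- The span of the model space of `m` and the signal `f`. -/
def spaceWith (m : DesignPartition N) (f : EuclideanSpace ℝ (Fin N)) :
    Submodule ℝ (EuclideanSpace ℝ (Fin N)) := m.space ⊔ Submodule.span ℝ {f}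

lemma finrank_spaceWith_le (hN : 1 ≤ N) (m : DesignPartition N) (f : EuclideanSpace ℝ (Fin N)) :
    Module.finrank ℝ (m.spaceWith f) ≤ m.clusterDim + 2 := by
  have h1 := Submodule.finrank_add_le_finrank_add_finrank m.space (Submodule.span ℝ {f})
  have h2 := m.finrank_space_le
  have h3 : Module.finrank ℝ (Submodule.span ℝ {f}) ≤ 1 := by
    simpa using finrank_span_le_card (R := ℝ) ({f} : Set (EuclideanSpace ℝ (Fin N)))
  rw [← m.clusterDim_add_one hN] at h2
  unfold spaceWith
  omega

end DesignPartition

lemma two_mul_inner_le_of_mem {E : Type*} [NormedAddCommGroup E] [InnerProductSpace ℝ E]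
    (S : Submodule ℝ E) [S.HasOrthogonalProjection] {a : ℝ} (ha : 0 < a) {x : E} (hx : x ∈ S)
    (e : E) : 2 * inner ℝ e x ≤ ‖x‖ ^ 2 / a + a * ‖S.starProjection e‖ ^ 2 := by
  have h1 : inner ℝ e x = inner ℝ (S.starProjection e) x := by
    rw [Submodule.inner_starProjection_left_eq_right, Submodule.starProjection_eq_self_iff.2 hx]
  have h2 := real_inner_le_norm (S.starProjection e) x
  have h3 : 0 ≤ (‖x‖ - a * ‖S.starProjection e‖) ^ 2 / a := by positivity
  have h4 : (‖x‖ - a * ‖S.starProjection e‖) ^ 2 / a =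
      ‖x‖ ^ 2 / a + a * ‖S.starProjection e‖ ^ 2 - 2 * (‖S.starProjection e‖ * ‖x‖) := by
    field_simp
    ring
  rw [h1]
  linarith

/-- Comparison of two projection estimators whose penalized residuals are ordered. -/
lemma norm_sq_starProjection_sub_le {E : Type*} [NormedAddCommGroup E] [InnerProductSpace ℝ E]
    (F G S : Submodule ℝ E) [F.HasOrthogonalProjection] [G.HasOrthogonalProjection]
    [S.HasOrthogonalProjection] {a : ℝ} (ha : 0 < a) {f e : E} (hGS : G ≤ S) (hf : f ∈ S)
    {p q : ℝ} (h : ‖f + e - G.starProjection (f + e)‖ ^ 2 + q ≤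
      ‖f + e - F.starProjection (f + e)‖ ^ 2 + p) :
    (1 - 1 / a) * ‖G.starProjection (f + e) - f‖ ^ 2 ≤
      ‖F.starProjection (f + e) - f‖ ^ 2 + 2 * inner ℝ (f - F.starProjection f) e + p +
        (a * ‖S.starProjection e‖ ^ 2 - q) := by
  have hexp : ∀ g : E, ‖f + e - g‖ ^ 2 = ‖g - f‖ ^ 2 - 2 * inner ℝ e (g - f) + ‖e‖ ^ 2 := by
    intro g
    rw [show f + e - g = e - (g - f) by abel, norm_sub_sq_real]
    ring
  rw [hexp, hexp] at h
  have h1 := two_mul_inner_le_of_mem S ha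
    (S.sub_mem (hGS (G.starProjection_apply_mem (f + e))) hf) e
  -- The quadratic part `⟨e, Proj_F e⟩` is nonnegative and is dropped. What is left is linear in the
  -- noise, so it vanishes in expectation.
  have h2 : - inner ℝ e (F.starProjection (f + e) - f) ≤ inner ℝ (f - F.starProjection f) e := by
    rw [map_add, show F.starProjection f + F.starProjection e - f =
      F.starProjection e - (f - F.starProjection f) by abel, inner_sub_right,
      real_inner_comm (f - F.starProjection f)]
    have : (0 : ℝ) ≤ inner ℝ e (F.starProjection e) := by
      rw [← Submodule.starProjection_eq_self_iff.2 (F.starProjection_apply_mem e),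
        ← Submodule.inner_starProjection_left_eq_right]
      exact real_inner_self_nonneg
    linarith
  have h3 : (1 - 1 / a) * ‖G.starProjection (f + e) - f‖ ^ 2 =
    ‖G.starProjection (f + e) - f‖ ^ 2 - ‖G.starProjection (f + e) - f‖ ^ 2 / a := by ring
  linarith

/-! ### The finite penalties and the deviation bound for one model. -/

/-- The penalty as a real number, for the models with at least two parts. -/
noncomputable def realPenalty {N : ℕ} (B : ℝ) (m : DesignPartition N) : ℝ :=
  2 * Real.log (1 / priorWeight B m) + (m.clusterDim + 1) * Real.log (N / m.clusterDim)

lemma mem_models {N : ℕ} {m : DesignPartition N} :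
    m ∈ models N ↔ Real.exp 1 * (m.clusterDim : ℝ) ≤ N := by
  classical
  simp [models]

lemma one_le_log_div_clusterDim {N : ℕ} {m : DesignPartition N} (hm : m ∈ models N)
    (hd : 1 ≤ m.clusterDim) : 1 ≤ Real.log (N / m.clusterDim) := by
  have hd' : (0 : ℝ) < m.clusterDim := by exact_mod_cast hd
  have h := (le_div_iff₀ hd').2 (mem_models.1 hm)
  exact (Real.le_log_iff_exp_le ((Real.exp_pos 1).trans_le h)).2 h

lemma dimTerm_eq_top {N : ℕ} (hN : 1 ≤ N) {m : DesignPartition N} (hd : m.clusterDim = 0) :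
    dimTerm m = ⊤ := by
  have : (N : ℝ≥0∞) ≠ 0 := by
    simp only [ne_eq, Nat.cast_eq_zero]
    omega
  simp [dimTerm, hd, ENNReal.div_zero this]

lemma dimTerm_eq_coe {N : ℕ} (hN : 1 ≤ N) {m : DesignPartition N} (hd : 1 ≤ m.clusterDim) :
    dimTerm m = (((m.clusterDim + 1) * Real.log (N / m.clusterDim) : ℝ) : EReal) := by
  have hd' : (0 : ℝ) < m.clusterDim := by exact_mod_cast hd
  have hN' : (0 : ℝ) < N := by exact_mod_cast hN
  have h : (N : ℝ≥0∞) / (m.clusterDim : ℝ≥0∞) = ENNReal.ofReal (N / m.clusterDim) := by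
    rw [ENNReal.ofReal_div_of_pos hd', ENNReal.ofReal_natCast, ENNReal.ofReal_natCast]
  rw [dimTerm, h, ENNReal.log_ofReal_of_pos (by positivity), EReal.coe_mul]

lemma criterion_eq_coe {N : ℕ} (hN : 1 ≤ N) (σ K B : ℝ) (y : EuclideanSpace ℝ (Fin N))
    {m : DesignPartition N} (hd : 1 ≤ m.clusterDim) :
    criterion σ K B y m =
      ((‖y - m.space.starProjection y‖ ^ 2 + σ ^ 2 * K * realPenalty B m : ℝ) : EReal) := by
  rw [criterion, penalty, dimTerm_eq_coe hN hd, ← EReal.coe_add, ← EReal.coe_mul, ← EReal.coe_add]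
  rfl

lemma criterion_eq_top {N : ℕ} (hN : 1 ≤ N) {σ K : ℝ} (h : 0 < σ ^ 2 * K) (B : ℝ)
    (y : EuclideanSpace ℝ (Fin N)) {m : DesignPartition N} (hd : m.clusterDim = 0) :
    criterion σ K B y m = ⊤ := by
  rw [criterion, penalty, dimTerm_eq_top hN hd, EReal.coe_add_top, EReal.coe_mul_top_of_pos h,
    EReal.coe_add_top]

/-- Each dimension costs `r = √(3/2)`, and each of the `n + 1` parts gains `exp (-1/2) ≤ 2/3`. One
gain pays for two dimensions, since `r ^ 2 * exp (-1/2) ≤ 1`, and this absorbs the extra dimension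
spanned by the signal. -/
lemma sqrt_inv_pow_mul_exp_le_one {k n : ℕ} (hk : k ≤ n + 2) :
    (√(1 - 2 * (1 / 6 : ℝ)))⁻¹ ^ k * Real.exp (-((n + 1 : ℝ) / 2)) ≤ 1 := by
  set r : ℝ := (√(1 - 2 * (1 / 6 : ℝ)))⁻¹ with hr
  have hr2 : r ^ 2 = 3 / 2 := by
    rw [hr, inv_pow, Real.sq_sqrt (by norm_num)]
    norm_num
  have hr0 : 0 ≤ r := by positivity
  have hr1 : 1 ≤ r := by nlinarith
  have hr3 : r ≤ 3 / 2 := by nlinarith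
  have he : Real.exp (-(1 / 2)) ≤ 2 / 3 := by
    have := Real.add_one_le_exp (1 / 2 : ℝ)
    rw [Real.exp_neg]
    exact (inv_anti₀ (by norm_num) this).trans (by norm_num)
  have hre : r * Real.exp (-(1 / 2)) ≤ 1 := by
    nlinarith [Real.exp_pos (-(1 / 2))]
  calc r ^ k * Real.exp (-((n + 1 : ℝ) / 2))
      ≤ r ^ (n + 2) * Real.exp (-(1 / 2)) ^ (n + 1) := by
        rw [← Real.exp_nat_mul]
        refine mul_le_mul (pow_le_pow_right₀ hr1 hk) (le_of_eq ?_) (Real.exp_pos _).le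
          (by positivity)
        congr 1
        push_cast
        ring
    _ = r ^ 2 * Real.exp (-(1 / 2)) * (r * Real.exp (-(1 / 2))) ^ n := by ring
    _ ≤ 1 * 1 := by
        refine mul_le_mul ?_ (pow_le_one₀ (by positivity) hre) (by positivity) (by norm_num)
        rw [hr2]
        linarith
    _ = 1 := one_mul 1

section Risk

variable {Ω : Type*} [MeasurableSpace Ω] {P : Measure Ω} {N : ℕ} {v : ℝ≥0}
  {ε : Ω → EuclideanSpace ℝ (Fin N)}

lemma integrable_norm_sq_starProjection_sub
    (hlaw : ∀ i, HasLaw (fun ω => ε ω i) (gaussianReal 0 v) P)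
    (hindep : iIndepFun (fun i ω => ε ω i) P) (f : EuclideanSpace ℝ (Fin N))
    (F : Submodule ℝ (EuclideanSpace ℝ (Fin N))) :
    Integrable (fun ω => ‖F.starProjection (f + ε ω) - f‖ ^ 2) P := by
  have := hindep.isProbabilityMeasure
  have hε : MemLp ε 2 P := (hasGaussianLaw_of_iIndepFun_coord hlaw hindep).memLp_two
  have h : MemLp (fun ω => F.starProjection (f + ε ω) - f) 2 P :=
    (F.starProjection.comp_memLp' ((memLp_const f).add hε)).sub (memLp_const f)
  exact (memLp_two_iff_integrable_sq_norm h.1).1 h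

variable [IsProbabilityMeasure P]

lemma integral_exp_deviation_le (hN : 1 ≤ N)
    (hlaw : ∀ i, HasLaw (fun ω => ε ω i) (gaussianReal 0 v) P)
    (hindep : iIndepFun (fun i ω => ε ω i) P) (hv : v ≠ 0) (f : EuclideanSpace ℝ (Fin N))
    {B : ℝ} (hB : 0 < B) {m : DesignPartition N} (hm : m ∈ models N) (hd : 1 ≤ m.clusterDim) :
    ∫ ω, Real.exp (1 / 6 * ‖(m.spaceWith f).starProjection (ε ω)‖ ^ 2 / v) *
      Real.exp (-(realPenalty B m / 2)) ∂P ≤ priorWeight B m := by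
  have hp := priorWeight_pos hN hB m
  have hlog := one_le_log_div_clusterDim hm hd
  rw [integral_mul_const, integral_exp_norm_sq_starProjection hlaw hindep hv _ (by norm_num)]
  -- Half of `2 ln (1/p_m)` yields the factor `p_m`; the other half-term is at least `(d' + 1) / 2`
  -- because `ln (N/d') ≥ 1`.
  have hpen : Real.exp (-(realPenalty B m / 2)) ≤
      Real.exp (-((m.clusterDim + 1 : ℝ) / 2)) * priorWeight B m := by
    nth_rw 1 [← Real.exp_log hp]
    rw [← Real.exp_add, Real.exp_le_exp, realPenalty, one_div, Real.log_inv]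
    nlinarith [(Nat.cast_nonneg m.clusterDim : (0 : ℝ) ≤ _)]
  calc _ ≤ (√(1 - 2 * (1 / 6 : ℝ)))⁻¹ ^ Module.finrank ℝ (m.spaceWith f) *
        (Real.exp (-((m.clusterDim + 1 : ℝ) / 2)) * priorWeight B m) :=
        mul_le_mul_of_nonneg_left hpen (by positivity)
    _ ≤ 1 * priorWeight B m := by
        rw [← mul_assoc]
        exact mul_le_mul_of_nonneg_right
          (sqrt_inv_pow_mul_exp_le_one (m.finrank_spaceWith_le hN f)) hp.le
    _ = priorWeight B m := one_mul _

end Risk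

lemma integrable_comp_of_finite {Ω ι : Type*} [MeasurableSpace Ω] {P : Measure Ω} [Fintype ι]
    {T : Ω → ι} (hT : ∀ i, MeasurableSet {ω | T ω = i}) {g : ι → Ω → ℝ}
    (hg : ∀ i, Integrable (g i) P) : Integrable (fun ω => g (T ω) ω) P := by
  classical
  have h : (fun ω => g (T ω) ω) = fun ω => ∑ i, {ω | T ω = i}.indicator (g i) ω := by
    funext ω
    simp [Set.indicator_apply]
  rw [h]
  exact integrable_finsetSum _ fun i _ => (hg i).indicator (hT i)

/-! ### The oracle inequality. -/

theorem theorem6p1 {Ω : Type*} [MeasurableSpace Ω] (P : Measure Ω) [IsProbabilityMeasure P]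
    (N : ℕ) (hN : 1 ≤ N) (σ : ℝ≥0) (hσ : 0 < σ)
    (f : EuclideanSpace ℝ (Fin N)) (ε Y : Ω → EuclideanSpace ℝ (Fin N))
    -- the noise has independent coordinates with law `N(0, σ²)`
    (hε_law : ∀ i, HasLaw (fun ω => ε ω i) (gaussianReal 0 (σ ^ 2)) P)
    (hε_indep : iIndepFun (fun i ω => ε ω i) P)
    (hY : ∀ ω, Y ω = f + ε ω)
    -- the normalizing factor of the weights: the explicit one, or any other one that gives the
    -- collection of models total weight at most one
    (B : ℝ)
    (hB : B = priorConst N ∨ (0 < B ∧ ∑ m ∈ models N, priorWeight B m ≤ 1))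
    (a : ℝ) (ha : 1 < a)
    -- the selected model is a measurable minimizer of the criterion with `K = 3a`
    (mhat : Ω → DesignPartition N)
    (hmhat_meas : ∀ m, MeasurableSet {ω | mhat ω = m})
    (hmhat_mem : ∀ ω, mhat ω ∈ models N)
    (hmhat_min : ∀ ω, ∀ m ∈ models N,
      criterion (σ : ℝ) (3 * a) B (Y ω) (mhat ω) ≤ criterion (σ : ℝ) (3 * a) B (Y ω) m) :
    Integrable (fun ω => ‖(mhat ω).space.starProjection (Y ω) - f‖ ^ 2) P ∧
    ((∫ ω, ‖(mhat ω).space.starProjection (Y ω) - f‖ ^ 2 ∂P : ℝ) : EReal) ≤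
      ⨅ m ∈ models N,
        (((a / (a - 1) * ∫ ω, ‖m.space.starProjection (Y ω) - f‖ ^ 2 ∂P : ℝ) : EReal) +
          ((a ^ 2 * (σ : ℝ) ^ 2 / (a - 1) : ℝ) : EReal) *
            (7 + 3 * dimTerm m + ((6 * Real.log (1 / priorWeight B m) : ℝ) : EReal))) := by
  obtain ⟨hB0, hB1⟩ : 0 < B ∧ ∑ m ∈ models N, priorWeight B m ≤ 1 := by
    rcases hB with rfl | h
    · exact ⟨priorConst_pos hN, sum_priorWeight_priorConst_le_one hN⟩
    · exact h
  obtain rfl : Y = fun ω => f + ε ω := funext hY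
  have ha0 : 0 < a := by linarith
  have ha1 : 0 < a - 1 := by linarith
  have hσ0 : (0 : ℝ) < σ := hσ
  have hv : σ ^ 2 ≠ 0 := by positivity
  have hrisk : ∀ m : DesignPartition N,
      Integrable (fun ω => ‖m.space.starProjection (f + ε ω) - f‖ ^ 2) P := fun m =>
    integrable_norm_sq_starProjection_sub hε_law hε_indep f m.space
  have hint : Integrable (fun ω => ‖(mhat ω).space.starProjection (f + ε ω) - f‖ ^ 2) P :=
    integrable_comp_of_finite hmhat_meas hrisk
  refine ⟨hint, le_iInf₂ fun m hm => ?_⟩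
  -- For the one-part partition the right-hand side is `⊤`.
  rcases Nat.eq_zero_or_pos m.clusterDim with hd | hd
  · have h7 : (7 : EReal) ≠ ⊥ := EReal.coe_ne_bot 7
    rw [dimTerm_eq_top hN hd, EReal.mul_top_of_pos (by norm_num), EReal.add_top_of_ne_bot h7,
      EReal.top_add_coe, EReal.coe_mul_top_of_pos (by positivity), EReal.coe_add_top]
    exact le_top
  let M := (models N).filter fun m => 1 ≤ m.clusterDim
  let Z : DesignPartition N → Ω → ℝ := fun m ω =>
    Real.exp (1 / 6 * ‖(m.spaceWith f).starProjection (ε ω)‖ ^ 2 / (σ ^ 2 : ℝ≥0)) *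
      Real.exp (-(realPenalty B m / 2))
  have hZ_int : ∀ m, Integrable (Z m) P := fun m =>
    (integrable_exp_norm_sq_starProjection hε_law hε_indep hv _ (by norm_num)).mul_const _
  have hZ_sum : ∫ ω, ∑ m ∈ M, Z m ω ∂P ≤ 1 := by
    rw [integral_finsetSum _ fun m _ => hZ_int m]
    calc ∑ m ∈ M, ∫ ω, Z m ω ∂P ≤ ∑ m ∈ M, priorWeight B m :=
          Finset.sum_le_sum fun m hm => integral_exp_deviation_le hN hε_law hε_indep hv f hB0
            (Finset.mem_filter.1 hm).1 (Finset.mem_filter.1 hm).2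
      _ ≤ ∑ m ∈ models N, priorWeight B m :=
          Finset.sum_le_sum_of_subset_of_nonneg (Finset.filter_subset _ _)
            fun m _ _ => priorWeight_nonneg hB0 m
      _ ≤ 1 := hB1
  have hpoint : ∀ ω, (1 - 1 / a) * ‖(mhat ω).space.starProjection (f + ε ω) - f‖ ^ 2 ≤
      ‖m.space.starProjection (f + ε ω) - f‖ ^ 2 +
        2 * inner ℝ (f - m.space.starProjection f) (ε ω) + (σ : ℝ) ^ 2 * (3 * a) * realPenalty B m +
        6 * a * (σ : ℝ) ^ 2 * ∑ m ∈ M, Z m ω := by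
    intro ω
    have hmin := hmhat_min ω m hm
    rw [criterion_eq_coe hN _ _ _ _ hd] at hmin
    -- The competitor `m` has a finite criterion, so the one-part partition, whose criterion is `⊤`,
    -- is not selected.
    have hdhat : 1 ≤ (mhat ω).clusterDim := by
      by_contra! h
      rw [criterion_eq_top hN (by positivity) B _ (by omega)] at hmin
      exact EReal.coe_ne_top _ (top_le_iff.1 hmin)
    rw [criterion_eq_coe hN _ _ _ _ hdhat, EReal.coe_le_coe_iff] at hmin
    have h := norm_sq_starProjection_sub_le m.space (mhat ω).space ((mhat ω).spaceWith f) ha0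
      le_sup_left (Submodule.mem_sup_right (Submodule.mem_span_singleton_self f)) hmin
    -- The selected model depends on the noise; the sum over all models does not involve the
    -- selection.
    have hZ : Z (mhat ω) ω ≤ ∑ m ∈ M, Z m ω :=
      Finset.single_le_sum (f := fun m => Z m ω) (fun m _ => by positivity)
        (Finset.mem_filter.2 ⟨hmhat_mem ω, hdhat⟩)
    have hexp : a * ‖((mhat ω).spaceWith f).starProjection (ε ω)‖ ^ 2 -
        (σ : ℝ) ^ 2 * (3 * a) * realPenalty B (mhat ω) ≤ 6 * a * (σ : ℝ) ^ 2 * Z (mhat ω) ω := by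
      simp only [Z]
      rw [← Real.exp_add]
      set s := ‖((mhat ω).spaceWith f).starProjection (ε ω)‖ ^ 2
      have h1 := Real.add_one_le_exp
        (1 / 6 * s / (σ ^ 2 : ℝ≥0) + -(realPenalty B (mhat ω) / 2))
      -- The choices `K = 3a` and exponent `1/6` match here: factoring out `6 a σ²` leaves exactly
      -- half the penalty.
      have h2 : a * s - (σ : ℝ) ^ 2 * (3 * a) * realPenalty B (mhat ω) =
          6 * a * (σ : ℝ) ^ 2 * (1 / 6 * s / (σ ^ 2 : ℝ≥0) + -(realPenalty B (mhat ω) / 2)) := by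
        push_cast
        field_simp
        ring
      rw [h2]
      exact mul_le_mul_of_nonneg_left (by linarith) (by positivity)
    have := mul_le_mul_of_nonneg_left hZ (show 0 ≤ 6 * a * (σ : ℝ) ^ 2 by positivity)
    linarith
  have hinner : Integrable (fun ω => inner ℝ (f - m.space.starProjection f) (ε ω)) P :=
    (hasGaussianLaw_of_iIndepFun_coord hε_law hε_indep).integrable.const_inner _
  have hmain : (1 - 1 / a) * ∫ ω, ‖(mhat ω).space.starProjection (f + ε ω) - f‖ ^ 2 ∂P ≤
      (∫ ω, ‖m.space.starProjection (f + ε ω) - f‖ ^ 2 ∂P) +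
        (σ : ℝ) ^ 2 * (3 * a) * realPenalty B m + 6 * a * (σ : ℝ) ^ 2 := by
    have i1 := (hrisk m).add (hinner.const_mul 2)
    have i2 := i1.add (integrable_const ((σ : ℝ) ^ 2 * (3 * a) * realPenalty B m))
    have i3 := (integrable_finsetSum M fun m _ => hZ_int m).const_mul (6 * a * (σ : ℝ) ^ 2)
    have h := integral_mono (hint.const_mul (1 - 1 / a)) (i2.add i3) hpoint
    rw [integral_const_mul, integral_add' i2 i3, integral_add' i1 (integrable_const _),
      integral_add' (hrisk m) (hinner.const_mul 2), integral_const_mul, integral_const_mul,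
      integral_const_mul, integral_inner_noise_eq_zero hε_law, integral_const] at h
    have h6 : 0 ≤ 6 * a * (σ : ℝ) ^ 2 := by positivity
    have := mul_le_mul_of_nonneg_left hZ_sum h6
    simp only [probReal_univ, one_smul, mul_zero, add_zero, mul_one] at h this
    linarith
  have hreal : ∫ ω, ‖(mhat ω).space.starProjection (f + ε ω) - f‖ ^ 2 ∂P ≤
      a / (a - 1) * (∫ ω, ‖m.space.starProjection (f + ε ω) - f‖ ^ 2 ∂P) +
        a ^ 2 * (σ : ℝ) ^ 2 / (a - 1) * (7 + 3 * ((m.clusterDim + 1) *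
          Real.log (N / m.clusterDim)) + 6 * Real.log (1 / priorWeight B m)) := by
    -- The factor `a / (a - 1)` is the inverse of `1 - 1/a`. The resulting constant is `6`, which is
    -- weakened to `7`.
    have h := mul_le_mul_of_nonneg_left hmain (show 0 ≤ a / (a - 1) by positivity)
    have e1 : ∀ x : ℝ, a / (a - 1) * ((1 - 1 / a) * x) = x := by
      intro x
      field_simp
    have e2 : ∀ x y : ℝ, a / (a - 1) * (x + (σ : ℝ) ^ 2 * (3 * a) * y + 6 * a * (σ : ℝ) ^ 2) =
        a / (a - 1) * x + a ^ 2 * (σ : ℝ) ^ 2 / (a - 1) * (6 + 3 * y) := by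
      intro x y
      field_simp
      ring
    rw [e1, e2] at h
    refine h.trans (add_le_add_right (mul_le_mul_of_nonneg_left ?_ (by positivity)) _)
    rw [realPenalty]
    linarith
  rw [dimTerm_eq_coe hN hd]
  have h7 : (7 : EReal) = ((7 : ℝ) : EReal) := rfl
  have h3 : (3 : EReal) = ((3 : ℝ) : EReal) := rfl
  rw [h7, h3, ← EReal.coe_mul, ← EReal.coe_add, ← EReal.coe_add, ← EReal.coe_mul, ← EReal.coe_add]
  exact EReal.coe_le_coe_iff.2 hreal
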